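/- **Setting.** Let $j\ge 1$ and $\mathfrak p=1^{j+1}0^j$. A binary word is read as a lattice path from the origin: each $1$ is a rise step $x=(1,1)$, each $0$ a fall step $\overline x=(1,-1)$. Let $F$ be the set of binary words with at most as many zeros as ones, and $F^{[\mathfrak p]}\subseteq F$ the set of those in which $\mathfrak p$ does not occur as a block of consecutive letters. A *marked path* is a word $w\in F$ together with a set of occurrences of $\mathfrak p$ in $w$, which are called marked; equivalently, a sequence of the pieces $x$, $\overline x$ and $P$, where $P$ stands for a marked (indivisible) copy of $\mathfrak p$. The peak of a marked occurrence is called a marked point. **The rule.** Consider the labels $(k)$, $k\ge 0$, together with $(0_1)$ and $(0_2)$, both of value $0$, and their marked (overlined) versions. The jumping and marked succession rule is $$(0);\qquad (k)\stackrel{1}{\rightsquigarrow}(0_1)(0_2)(1)\cdots(k+1);\qquad (k)\stackrel{j+1}{\rightsquigarrow}(\overline{0_1})(\overline{0_2})(\overline 1)\cdots(\overline{k+1}).$$ Its tree has a root labelled $(0)$ at level $0$; a node at level $n$ with label value $k$ has $k+3$ sons at level $n+1$ and $k+3$ sons at level $n+j+1$, with the labels listed. The sons of a marked node carry the opposite marks,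 where $\overline{\overline{k}}=k$. **The construction.** Let $\omega$ be a marked path whose endpoint has ordinate $k$. Put $a=x$ for the first production and $a=P$ for the second. For the labels $(0_2),(1),\dots,(k+1)$, that is, for $h=0,1,\dots,k+1$, the son of $\omega$ is $\omega\,a\,\overline x^{\,k+1-h}$. For $(0_1)$, write $\omega\,a\,\overline x^{\,k}=v\varphi$, where $\varphi$ is the rightmost suffix that begins on the $x$-axis and then remains strictly above it. * If $\varphi$ contains no marked point, the son is $v\varphi^{c}x$, where $\varphi^c$ is $\varphi$ with rise and fall steps switched. * Otherwise consider only the points of $\varphi$ that are not strictly inside a marked occurrence. Let $r$ be the rightmost among the marked points of $\varphi$ of highest ordinate; let $t$ be the leftmost of the highest points to the right of the marked occurrence containing $r$ (its final point included); let $z$ be the leftmost of the highest points lying on or above the horizontal line through $t$. Cut $\varphi=\beta\alpha$ at $z$; the son is $v\,\overline x\,\alpha\,\beta$. The generating tree of paths is the directed graph whose nodes are all marked paths, rooted at the empty path, with the edges given by this construction. The level of a marked path is its number of ones (rise steps), its label value is the ordinate of its endpoint, and its label is marked if and only if its number of marked occurrences is odd. **Theorem.** The generating tree of paths is a rooted tree,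 and it is isomorphic to the tree of the succession rule, by an isomorphism that respects the root, the sons (with the production and the label that give them), the levels, the label values and the marks. For this isomorphism, which assigns to each node of the tree of the rule the marked path that it generates: 1. For every $w\in F$ and every set $S$ of occurrences of $\mathfrak p$ in $w$, exactly one node generates $w$ with exactly the occurrences in $S$ marked. The marked patterns of each generated path are occurrences of $\mathfrak p$ in its word, and the label of the node is marked if and only if their number is odd. 2. Every $w\in F$ with exactly $C$ occurrences of $\mathfrak p$ is generated by exactly $2^C$ nodes. If $C\ge1$, then $2^{C-1}$ of these nodes have a marked label and $2^{C-1}$ a non-marked one. If $C=0$, that is $w\in F^{[\mathfrak p]}$, the single node has a non-marked label. 3. For every node whose word $w$ contains $\mathfrak p$, there is exactly one node that generates the same word $w$, with the same marked occurrences except that the last occurrence of $\mathfrak p$ in $w$ is marked if and only if it was not, and that lies on the same level and has the same label value and the opposite mark. 4. Every level of the tree is finite. For all $n,k\ge0$, the number of non-marked nodes of value $k$ at level $n$ minus the number of marked nodes of value $k$ at level $n$ is the number of words in $F^{[\mathfrak p]}$ with $n$ ones whose path ends at ordinate $k$. Likewise, the number of non-marked nodes at level $n$ minus the number of marked ones is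 the number of words in $F^{[\mathfrak p]}$ with $n$ ones. -/

import Mathlib

namespace PatternTree

/-! ### Binary words and the forbidden pattern -/

/-- The ordinate of the endpoint of the lattice path of a binary word: the letter `1` (`true`) is
the rise step `(1, 1)`, the letter `0` (`false`) is the fall step `(1, -1)`. -/
def ordinate (w : List Bool) : ℤ := (w.count true : ℤ) - (w.count false : ℤ)

/-- The class `F` of binary words with at most as many zeros as ones. -/
def InF (w : List Bool) : Prop := w.count false ≤ w.count true

/-- The pattern `1^(j+1) 0^j`. -/
def pattern (j : ℕ) : List Bool := List.replicate (j + 1) true ++ List.replicate j false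

/-- The word avoids the pattern: the pattern is not a block of consecutive letters of it. -/
def Avoids (j : ℕ) (w : List Bool) : Prop := ¬ pattern j <:+: w

/-- The starting indices of the occurrences of the pattern in `w`. -/
def occurrences (j : ℕ) (w : List Bool) : Finset ℕ :=
  (Finset.range (w.length + 1)).filter fun i => pattern j <+: w.drop i

/-! ### Paths with marked forbidden patterns -/

/-- The pieces of a path with marked forbidden patterns: rise steps, fall steps, and marked
forbidden patterns, which are never divided and so are single pieces. -/
inductive Piece
  | rise
  | fall
  | marked
  deriving DecidableEq

/-- The binary word of a single piece. -/
def Piece.word (j : ℕ) : Piece → List Bool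
  | .rise => [true]
  | .fall => [false]
  | .marked => pattern j

/-- The binary word obtained by forgetting the marks. -/
def word (j : ℕ) (ω : List Piece) : List Bool := ω.flatMap (Piece.word j)

/-- The starting indices, in the word of `ω`, of the marked forbidden patterns of `ω`. -/
def markedPositions (j : ℕ) (ω : List Piece) : Finset ℕ :=
  ((Finset.range ω.length).filter fun i => ω[i]? = some Piece.marked).image
    fun i => (word j (ω.take i)).length

/-- The ordinate of the `i`-th point of `ω` among the points that are not strictly within a marked
forbidden pattern (the points between two consecutive pieces and the two endpoints). -/
def ordAt (j : ℕ) (ω : List Piece) (i : ℕ) : ℤ := ordinate (word j (ω.take i))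

/-! ### The cut and paste construction -/

/-- The leftmost index in `s` at which `f` is largest on `s`. -/
def leftmostHighest (f : ℕ → ℤ) (s : Finset ℕ) : ℕ :=
  (s.filter fun i => ∀ i' ∈ s, f i' ≤ f i).min.untopD 0

/-- The rightmost index in `s` at which `f` is largest on `s`. -/
def rightmostHighest (f : ℕ → ℤ) (s : Finset ℕ) : ℕ :=
  (s.filter fun i => ∀ i' ∈ s, f i' ≤ f i).max.unbotD 0

/-- The index of the last point of `ω` that lies on the `x`-axis. (The points strictly within a
marked forbidden pattern need not be inspected: they lie above the initial point of the pattern, so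
a path that ends at ordinate `1` never meets the axis for the last time there.) -/
def lastAxisPoint (j : ℕ) (ω : List Piece) : ℕ :=
  ((Finset.range (ω.length + 1)).filter fun i => ordAt j ω i = 0).max.unbotD 0

/-- The piece number of the marked forbidden pattern containing `r`, the rightmost marked point
(peak of a marked forbidden pattern) of highest ordinate. A peak lies `j + 1` above the initial
point of its pattern. -/
def pieceR (j : ℕ) (φ : List Piece) : ℕ :=
  rightmostHighest (fun i => ordAt j φ i + ((j : ℤ) + 1))
    ((Finset.range φ.length).filter fun i => φ[i]? = some Piece.marked)

/-- The point `t`: the nearest of the highest points on the right of the marked forbidden pattern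
containing `r`. -/
def pointT (j : ℕ) (φ : List Piece) : ℕ :=
  leftmostHighest (ordAt j φ) (Finset.Icc (pieceR j φ + 1) φ.length)

/-- The point `z`: the leftmost of the highest points that lie above or on the horizontal line
through `t`. -/
def pointZ (j : ℕ) (φ : List Piece) : ℕ :=
  leftmostHighest (ordAt j φ)
    ((Finset.range (φ.length + 1)).filter fun i => ordAt j φ (pointT j φ) ≤ ordAt j φ i)

/-- Switching rise and fall steps. It is applied only to paths without marked patterns. -/
def switch : Piece → Piece
  | .rise => .fall
  | .fall => .rise
  | .marked => .marked

/-- The cut and paste actions. The path is written `v φ`, with `φ` the rightmost suffix that begins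
on the `x`-axis and then stays strictly above it. If `φ` has no marked point the result is
`v φᶜ x`; otherwise `φ = β α` is cut at `z` and the result is `v x̄ α β`. -/
def cutPaste (j : ℕ) (ω : List Piece) : List Piece :=
  let i := lastAxisPoint j ω
  let v := ω.take i
  let φ := ω.drop i
  if Piece.marked ∈ φ then
    v ++ Piece.fall :: (φ.drop (pointZ j φ) ++ φ.take (pointZ j φ))
  else
    v ++ φ.map switch ++ [Piece.rise]

/-! ### The succession rule and its tree -/

/-- The labels `(k)` and the two labels `(0₁)`, `(0₂)`. -/
inductive Label
  | num (k : ℕ)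
  | zeroOne
  | zeroTwo
  deriving DecidableEq

/-- The numerical value of a label. -/
def Label.value : Label → ℕ
  | .num k => k
  | .zeroOne => 0
  | .zeroTwo => 0

/-- The two productions: the first one jumps by one level and does not mark, the second one jumps
by `j + 1` levels and marks. -/
inductive Production
  | first
  | second
  deriving DecidableEq

/-- The number of levels by which a production jumps. -/
def Production.jump (j : ℕ) : Production → ℕ
  | .first => 1
  | .second => j + 1

/-- Whether a production marks the labels that it produces. -/
def Production.marks : Production → Bool
  | .first => false
  | .second => true

/-- The piece that a production adds to a path. -/
def Production.piece : Production → Piece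
  | .first => .rise
  | .second => .marked

/-- The labels `(0₁)(0₂)(1)(2)⋯(k+1)` produced by `(k)`. -/
def ruleSons (k : ℕ) : List Label :=
  Label.zeroOne :: Label.zeroTwo :: (List.range (k + 1)).map fun i => Label.num (i + 1)

/-- The value of the last label of a code. A code lists the productions used, with the labels
chosen, on the way from the root to a node, the last one first; the root has the label `(0)`. -/
def codeValue : List (Production × Label) → ℕ
  | [] => (Label.num 0).value
  | e :: _ => e.2.value

/-- The codes of the nodes: each label is one of those produced by the label before it. -/
def IsCode : List (Production × Label) → Prop
  | [] => True
  | e :: c => e.2 ∈ ruleSons (codeValue c) ∧ IsCode c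

/-- The level of a node: the root lies at level `0`. -/
def codeLevel (j : ℕ) (c : List (Production × Label)) : ℕ :=
  (c.map fun e => e.1.jump j).sum

/-- Whether the label of a node is marked; marking a marked label unmarks it. -/
def codeMarked : List (Production × Label) → Bool
  | [] => false
  | e :: c => xor e.1.marks (codeMarked c)

/-- The path obtained from `ω` by the given production for the given label. With `k` the ordinate
of the endpoint of `ω`, the labels `(0₂), (1), …, (k+1)` stand for the ordinates `h = 0, 1, …, k+1`:
the piece of the production followed by `k + 1 - h` fall steps is added to `ω`. For `(0₁)` the piece
followed by `k` fall steps is added and the cut and paste actions are performed. -/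
def construct (j : ℕ) (p : Production) (l : Label) (ω : List Piece) : List Piece :=
  let k := (ordinate (word j ω)).toNat
  match l with
  | .zeroOne => cutPaste j (ω ++ p.piece :: List.replicate k Piece.fall)
  | .zeroTwo => ω ++ p.piece :: List.replicate (k + 1) Piece.fall
  | .num h => ω ++ p.piece :: List.replicate (k + 1 - h) Piece.fall

/-- A rooted directed graph whose edges carry a production and a label and whose nodes carry a
level and a label value that is marked or not. -/
structure LabelledDigraph where
  Node : Type
  root : Node
  /-- `son p l x y`: the node `y` is the son of `x` by the production `p` for the label `l`. -/
  son : Production → Label → Node → Node → Prop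
  level : Node → ℕ
  value : Node → ℕ
  marked : Node → Bool

/-- The digraph is a tree: the root has no parent, every other node has exactly one incoming edge,
and all nodes are descendants of the root. -/
def LabelledDigraph.IsRootedTree (T : LabelledDigraph) : Prop :=
  (∀ p l x, ¬ T.son p l x T.root) ∧
  (∀ y, y ≠ T.root → ∃! e : Production × Label × T.Node, T.son e.1 e.2.1 e.2.2 y) ∧
  ∀ y, Relation.ReflTransGen (fun x x' => ∃ p l, T.son p l x x') T.root y

/-- Isomorphisms of such digraphs respect all of the data. -/
structure LabelledDigraph.Iso (T U : LabelledDigraph) where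
  toEquiv : T.Node ≃ U.Node
  map_root : toEquiv T.root = U.root
  map_son : ∀ p l x y, U.son p l (toEquiv x) (toEquiv y) ↔ T.son p l x y
  map_level : ∀ x, U.level (toEquiv x) = T.level x
  map_value : ∀ x, U.value (toEquiv x) = T.value x
  map_marked : ∀ x, U.marked (toEquiv x) = T.marked x

/-- The tree with root `(0)` defined by the jumping and marked succession rule
`(k) ⇝¹ (0₁)(0₂)(1)⋯(k+1)`, `(k) ⇝^(j+1)` the same labels marked. -/
def ruleTree (j : ℕ) : LabelledDigraph where
  Node := { c : List (Production × Label) // IsCode c }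
  root := ⟨[], trivial⟩
  son p l x y := y.1 = (p, l) :: x.1
  level x := codeLevel j x.1
  value x := codeValue x.1
  marked x := codeMarked x.1

/-- The generating tree of paths: its nodes are all the paths of `F` with some of their forbidden
patterns marked, its edges are given by the construction, the level is the number of rise steps, the
value is the ordinate of the endpoint, and the sign is the parity of the number of marked forbidden
patterns. -/
def pathTree (j : ℕ) : LabelledDigraph where
  Node := { ω : List Piece // InF (word j ω) }
  root := ⟨[], le_refl 0⟩
  son p l x y := l ∈ ruleSons (ordinate (word j x.1)).toNat ∧ y.1 = construct j p l x.1
  level x := (word j x.1).count true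
  value x := (ordinate (word j x.1)).toNat
  marked x := decide (Odd (x.1.count Piece.marked))

/-- The marked path generated by a node of the tree of the rule, under a given isomorphism. -/
def LabelledDigraph.Iso.path {j : ℕ} (e : (ruleTree j).Iso (pathTree j)) (c : (ruleTree j).Node) :
    List Piece :=
  (e.toEquiv c).1

end PatternTree

namespace PatternTree

/-! ### Heights of paths of pieces -/

/-! A marked copy of the pattern climbs by `(j + 1) - j = 1`, exactly like a rise step. Seen only at
the points between pieces, a marked path is therefore a walk with steps `±1`, and all height
arguments treat `P` as a rise.

The theorem reduces to one bijection: every nonempty marked path of nonnegative height has exactly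
one parent, production and label (`construct_inj`, `exists_construct_eq`). To find them, cut such a
path at its last piece that is not a fall, as `τ a` followed by `m` falls. If `τ` has nonnegative
height, it is the parent, and the final height gives the label, which is not `(0₁)`. Otherwise `τ`
has height `-1` and `m = 0`: the path returns to the axis from below by its last piece. These are
exactly the results of cut and paste, which is a bijection from the paths of height `1` onto them
(`cutPaste_injOn`, `exists_cutPaste_eq`, `cutPaste_shape`).

Cut and paste turns the last positive stretch `φ` into a final negative excursion. Without marks
this is a reflection. With marks, `φ = β α` is cut at its leftmost highest point and becomes a fall
followed by `α β`; the junction of `α` and `β` is then the rightmost lowest point, so the cut can be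
recovered. The presence of a mark survives and tells the two cases apart.

Each production adds its jump to the number of ones, so descent to the parent terminates and codes
correspond to marked paths (`treeIso`). Occurrences of the pattern never overlap
(`pattern_no_overlap`), so marked paths over a word `w` correspond to arbitrary subsets of its
occurrences. The counts then follow from the fact that even and odd subsets of a nonempty set are
equally numerous (`card_even_sub_card_odd`). -/

/-- The rise of the ordinate along a piece. -/
def Piece.step : Piece → ℤ
  | .rise => 1
  | .fall => -1
  | .marked => 1

/-- The ordinate of the endpoint of a path of pieces. -/
def height (ω : List Piece) : ℤ := (ω.map Piece.step).sum

@[simp] lemma height_nil : height [] = 0 := rfl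

@[simp] lemma height_cons (p : Piece) (ω : List Piece) :
    height (p :: ω) = p.step + height ω := by simp [height]

@[simp] lemma height_append (a b : List Piece) : height (a ++ b) = height a + height b := by
  simp [height]

@[simp] lemma height_replicate_fall (n : ℕ) :
    height (List.replicate n Piece.fall) = -(n : ℤ) := by simp [height, Piece.step]

@[simp] lemma word_nil (j : ℕ) : word j [] = [] := rfl

@[simp] lemma word_cons (j : ℕ) (p : Piece) (ω : List Piece) :
    word j (p :: ω) = p.word j ++ word j ω := by simp [word]

@[simp] lemma word_append (j : ℕ) (a b : List Piece) :
    word j (a ++ b) = word j a ++ word j b := by simp [word]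

lemma ordinate_append (a b : List Bool) : ordinate (a ++ b) = ordinate a + ordinate b := by
  simp only [ordinate, List.count_append]; push_cast; ring

lemma ordinate_piece_word (j : ℕ) (p : Piece) : ordinate (p.word j) = p.step := by
  cases p <;> simp [Piece.word, ordinate, pattern, Piece.step, List.count_replicate]

lemma ordinate_word (j : ℕ) (ω : List Piece) : ordinate (word j ω) = height ω := by
  induction ω with
  | nil => simp [ordinate]
  | cons p ω ih => rw [word_cons, ordinate_append, ih, ordinate_piece_word, height_cons]

lemma ordAt_eq (j : ℕ) (ω : List Piece) (i : ℕ) : ordAt j ω i = height (ω.take i) :=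
  ordinate_word _ _

lemma inF_iff (w : List Bool) : InF w ↔ 0 ≤ ordinate w := by
  simp [InF, ordinate]

lemma step_eq (p : Piece) : p.step = 1 ∨ p.step = -1 := by cases p <;> simp [Piece.step]

/-! ### Decompositions of paths -/

/-- The path stays strictly above its initial point. -/
def StaysAbove (φ : List Piece) : Prop := ∀ a, a <+: φ → a ≠ [] → 0 < height a

/-- The path stays strictly below its initial point. -/
def StaysBelow (φ : List Piece) : Prop := ∀ a, a <+: φ → a ≠ [] → height a < 0

lemma prefix_append_iff {α : Type*} {l a b : List α} :
    l <+: a ++ b ↔ l <+: a ∨ ∃ c, c <+: b ∧ l = a ++ c := by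
  constructor
  · rintro ⟨t, h⟩
    rcases List.append_eq_append_iff.1 h with ⟨c, rfl, rfl⟩ | ⟨c, rfl, rfl⟩
    · exact Or.inl ⟨c, rfl⟩
    · exact Or.inr ⟨c, ⟨t, rfl⟩, rfl⟩
  · rintro (h | ⟨c, h, rfl⟩)
    · exact h.trans (List.prefix_append _ _)
    · exact (List.prefix_append_right_inj a).2 h

lemma StaysAbove.concat {φ : List Piece} (h : StaysAbove φ) {p : Piece}
    (hp : 0 < height (φ ++ [p])) : StaysAbove (φ ++ [p]) := by
  intro a ha hne
  rcases List.prefix_concat_iff.1 ha with rfl | ha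
  · exact hp
  · exact h a ha hne

lemma StaysBelow.concat {φ : List Piece} (h : StaysBelow φ) {p : Piece}
    (hp : height (φ ++ [p]) < 0) : StaysBelow (φ ++ [p]) := by
  intro a ha hne
  rcases List.prefix_concat_iff.1 ha with rfl | ha
  · exact hp
  · exact h a ha hne

lemma staysAbove_nil : StaysAbove [] := fun _ ha hne => absurd (List.prefix_nil.1 ha) hne

lemma staysBelow_nil : StaysBelow [] := fun _ ha hne => absurd (List.prefix_nil.1 ha) hne

lemma exists_last_axis_above (ω : List Piece) (h : 0 < height ω) :
    ∃ v φ, ω = v ++ φ ∧ height v = 0 ∧ StaysAbove φ := by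
  induction ω using List.reverseRecOn with
  | nil => simp at h
  | append_singleton ω p ih =>
    by_cases h0 : 0 < height ω
    · obtain ⟨v, φ, rfl, hv, hφ⟩ := ih h0
      refine ⟨v, φ ++ [p], by simp, hv, hφ.concat ?_⟩
      rw [List.append_assoc, height_append, hv] at h
      simpa using h
    · simp only [height_append, height_cons, height_nil] at h
      -- Steps are `±1`, so passing from a height `≤ 0` to a positive one starts exactly on the
      -- axis.
      refine ⟨ω, [p], rfl, by rcases step_eq p with h1 | h1 <;> omega, ?_⟩
      exact staysAbove_nil.concat (by simp; omega)

lemma exists_last_axis_below (ω : List Piece) (h : height ω < 0) :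
    ∃ v φ, ω = v ++ φ ∧ height v = 0 ∧ StaysBelow φ := by
  induction ω using List.reverseRecOn with
  | nil => simp at h
  | append_singleton ω p ih =>
    by_cases h0 : height ω < 0
    · obtain ⟨v, φ, rfl, hv, hφ⟩ := ih h0
      refine ⟨v, φ ++ [p], by simp, hv, hφ.concat ?_⟩
      rw [List.append_assoc, height_append, hv] at h
      simpa using h
    · simp only [height_append, height_cons, height_nil] at h
      refine ⟨ω, [p], rfl, by rcases step_eq p with h1 | h1 <;> omega, ?_⟩
      exact staysBelow_nil.concat (by simp; omega)

/-- Every path can be cut at the leftmost of its highest points. -/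
lemma exists_cut_first_highest (φ : List Piece) :
    ∃ β α, φ = β ++ α ∧ (∀ b, b <+: β → b ≠ β → height b < height β) ∧
      ∀ a, a <+: α → height a ≤ 0 := by
  induction φ with
  | nil => exact ⟨[], [], rfl, by simp, by simp⟩
  | cons p φ ih =>
    obtain ⟨β, α, rfl, hβ, hα⟩ := ih
    -- The old maximum competes with the new initial point, at height `0`. A tie goes to the initial
    -- point, which is further left.
    by_cases h : 0 < height (p :: β)
    · refine ⟨p :: β, α, rfl, ?_, hα⟩
      intro b hb hne
      rcases List.prefix_cons_iff.1 hb with rfl | ⟨t, rfl, ht⟩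
      · simpa using h
      · have := hβ t ht (by rintro rfl; exact hne rfl)
        simpa using this
    · refine ⟨[], p :: (β ++ α), rfl, by simp, ?_⟩
      intro a ha
      rcases List.prefix_cons_iff.1 ha with rfl | ⟨t, rfl, ht⟩
      · simp
      · simp only [height_cons] at h ⊢
        rcases prefix_append_iff.1 ht with ht | ⟨c, hc, rfl⟩
        · by_cases htβ : t = β
          · subst htβ; omega
          · have := hβ t ht htβ; omega
        · have := hα c hc
          rw [height_append]; omega

/-- Every path can be cut at the rightmost of its lowest points. -/
lemma exists_cut_last_lowest (γ : List Piece) :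
    ∃ α β, γ = α ++ β ∧ (∀ a, a <+: α → height α ≤ height a) ∧ StaysAbove β := by
  induction γ with
  | nil => exact ⟨[], [], rfl, by simp, staysAbove_nil⟩
  | cons p γ ih =>
    obtain ⟨α, β, rfl, hα, hβ⟩ := ih
    -- Here a tie goes to the old minimum, which is further right.
    by_cases h : height (p :: α) ≤ 0
    · refine ⟨p :: α, β, rfl, ?_, hβ⟩
      intro a ha
      rcases List.prefix_cons_iff.1 ha with rfl | ⟨t, rfl, ht⟩
      · simpa using h
      · have := hα t ht
        simpa using this
    · refine ⟨[], p :: (α ++ β), rfl, by simp, ?_⟩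
      intro b hb hne
      rcases List.prefix_cons_iff.1 hb with rfl | ⟨t, rfl, ht⟩
      · exact absurd rfl hne
      · simp only [height_cons] at h ⊢
        rcases prefix_append_iff.1 ht with ht | ⟨c, hc, rfl⟩
        · have := hα t ht; omega
        · by_cases hc0 : c = []
          · subst hc0; simp; omega
          · have := hβ c hc hc0
            rw [height_append]; omega

/-! ### The cut and paste actions -/

lemma leftmostHighest_eq {f : ℕ → ℤ} {s : Finset ℕ} {i : ℕ} (hi : i ∈ s)
    (hle : ∀ i' ∈ s, f i' ≤ f i) (hlt : ∀ i' ∈ s, i' < i → f i' < f i) :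
    leftmostHighest f s = i := by
  have : (s.filter fun i => ∀ i' ∈ s, f i' ≤ f i).min = (i : WithTop ℕ) := by
    apply le_antisymm
    · exact Finset.min_le (by simp [hi]; exact hle)
    · refine Finset.le_min fun a ha => ?_
      rw [Finset.mem_filter] at ha
      by_contra hlt'
      have h1 : a < i := by simpa using hlt'
      have := hlt a ha.1 h1
      have := ha.2 i hi
      omega
  rw [leftmostHighest, this]; rfl

lemma lastAxisPoint_eq (j : ℕ) {v φ : List Piece} (hv : height v = 0) (hφ : StaysAbove φ) :
    lastAxisPoint j (v ++ φ) = v.length := by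
  have : ((Finset.range ((v ++ φ).length + 1)).filter fun i => ordAt j (v ++ φ) i = 0).max
      = (v.length : WithBot ℕ) := by
    apply le_antisymm
    · refine Finset.max_le fun a ha => ?_
      simp only [Finset.mem_filter, Finset.mem_range, List.length_append, ordAt_eq] at ha
      by_contra hlt
      have h1 : v.length < a := WithBot.coe_lt_coe.1 (not_le.1 hlt)
      obtain ⟨ha1, ha2⟩ := ha
      rw [List.take_append, List.take_of_length_le h1.le, height_append, hv] at ha2
      have := hφ _ (List.take_prefix (a - v.length) φ) (by
        rw [Ne, List.take_eq_nil_iff]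
        rintro (h | rfl)
        · omega
        · simp at ha1; omega)
      omega
    · exact Finset.le_max (by simp [ordAt_eq, hv])
  rw [lastAxisPoint, this]; rfl

/-- The points on or above the line through `t` include all the highest points of the path, so `z`
is simply the leftmost highest point overall. Neither `r` nor `t` influences the result. -/
lemma pointZ_eq (j : ℕ) {β α : List Piece} (hβ : ∀ b, b <+: β → b ≠ β → height b < height β)
    (hα : ∀ a, a <+: α → height a ≤ 0) : pointZ j (β ++ α) = β.length := by
  have key : ∀ i, ordAt j (β ++ α) i ≤ height β := by
    intro i
    rw [ordAt_eq]
    rcases prefix_append_iff.1 (List.take_prefix i (β ++ α)) with h | ⟨c, hc, h⟩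
    · by_cases h' : List.take i (β ++ α) = β
      · rw [h']
      · exact (hβ _ h h').le
    · rw [h, height_append]; have := hα c hc; omega
  have hlen : ordAt j (β ++ α) β.length = height β := by simp [ordAt_eq]
  apply leftmostHighest_eq
  · simp [hlen, key]
  · intro i _; rw [hlen]; exact key i
  · intro i _ hi
    rw [hlen, ordAt_eq, List.take_append_of_le_length hi.le]
    refine hβ _ (List.take_prefix _ _) fun h => ?_
    have := congrArg List.length h
    simp at this; omega

lemma cutPaste_of_notMem (j : ℕ) {v φ : List Piece} (hv : height v = 0) (hφ : StaysAbove φ)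
    (hm : Piece.marked ∉ φ) : cutPaste j (v ++ φ) = v ++ φ.map switch ++ [Piece.rise] := by
  simp [cutPaste, lastAxisPoint_eq j hv hφ, hm]

lemma cutPaste_of_mem (j : ℕ) {v β α : List Piece} (hv : height v = 0)
    (hφ : StaysAbove (β ++ α)) (hm : Piece.marked ∈ β ++ α)
    (hβ : ∀ b, b <+: β → b ≠ β → height b < height β)
    (hα : ∀ a, a <+: α → height a ≤ 0) :
    cutPaste j (v ++ (β ++ α)) = v ++ Piece.fall :: (α ++ β) := by
  unfold cutPaste
  simp only [lastAxisPoint_eq j hv hφ, List.drop_left, List.take_left, pointZ_eq j hβ hα, hm,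
    if_true]

lemma height_map_switch {φ : List Piece} (hm : Piece.marked ∉ φ) :
    height (φ.map switch) = -height φ := by
  induction φ with
  | nil => simp
  | cons p φ ih =>
    simp only [List.mem_cons, not_or] at hm
    rw [List.map_cons, height_cons, height_cons, ih hm.2]
    cases p <;> simp_all [switch, Piece.step] <;> ring

/-! ### Invertibility of the cut and paste actions. -/

/-- The path lies strictly below its initial point, except for its endpoint, which lies on the
same level. -/
structure IsNegativeExcursion (ψ : List Piece) : Prop where
  ne_nil : ψ ≠ []
  height_eq : height ψ = 0
  height_lt : ∀ a, a <+: ψ → a ≠ [] → a ≠ ψ → height a < 0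

/-- Of two different cuts, the later would be an interior point of the other excursion lying on the
axis. -/
lemma IsNegativeExcursion.append_inj {v v' ψ ψ' : List Piece} (h : IsNegativeExcursion ψ)
    (h' : IsNegativeExcursion ψ') (hv : height v = 0) (hv' : height v' = 0)
    (he : v ++ ψ = v' ++ ψ') : v = v' ∧ ψ = ψ' := by
  rcases List.append_eq_append_iff.1 he with ⟨c, rfl, rfl⟩ | ⟨c, rfl, rfl⟩
  · by_cases hc : c = []
    · subst hc; simp
    · have := h.height_lt c (List.prefix_append _ _) hc (by simp [h'.ne_nil])
      simp [hv] at hv'; omega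
  · by_cases hc : c = []
    · subst hc; simp
    · have := h'.height_lt c (List.prefix_append _ _) hc (by simp [h.ne_nil])
      simp [hv'] at hv; omega

lemma switch_switch (p : Piece) : switch (switch p) = p := by cases p <;> rfl

lemma marked_mem_map_switch (φ : List Piece) : Piece.marked ∈ φ.map switch ↔ Piece.marked ∈ φ := by
  rw [List.mem_map]
  constructor
  · rintro ⟨p, hp, h⟩; cases p <;> simp_all [switch]
  · exact fun h => ⟨_, h, rfl⟩

/-- The two shapes of the result of the cut and paste actions. -/
inductive IsCutPaste : List Piece → List Piece → Prop
  | switch {φ : List Piece} (hm : Piece.marked ∉ φ) : IsCutPaste φ (φ.map switch ++ [Piece.rise])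
  | paste {β α : List Piece} (hm : Piece.marked ∈ β ++ α)
      (hβ : ∀ b, b <+: β → b ≠ β → height b < height β)
      (hα : ∀ a, a <+: α → height a ≤ 0) : IsCutPaste (β ++ α) (Piece.fall :: (α ++ β))

lemma exists_isCutPaste (φ : List Piece) : ∃ ψ, IsCutPaste φ ψ := by
  by_cases hm : Piece.marked ∈ φ
  · obtain ⟨β, α, rfl, hβ, hα⟩ := exists_cut_first_highest φ
    exact ⟨_, .paste hm hβ hα⟩
  · exact ⟨_, .switch hm⟩

lemma IsCutPaste.cutPaste_eq (j : ℕ) {v φ ψ : List Piece} (h : IsCutPaste φ ψ)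
    (hv : height v = 0) (hφ : StaysAbove φ) : cutPaste j (v ++ φ) = v ++ ψ := by
  cases h with
  | switch hm => rw [cutPaste_of_notMem j hv hφ hm, List.append_assoc]
  | paste hm hβ hα => exact cutPaste_of_mem j hv hφ hm hβ hα

lemma IsCutPaste.marked_mem_iff {φ ψ : List Piece} (h : IsCutPaste φ ψ) :
    Piece.marked ∈ ψ ↔ Piece.marked ∈ φ := by
  cases h with
  | switch hm => simp [hm, marked_mem_map_switch, -List.mem_map]
  | paste hm hβ hα => simp [or_comm]

/-- Reflection sends the positive stretch below the axis, and the appended rise closes it. In the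
other case the leading fall pushes `α`, which never exceeds its start, below the axis; `β` attains
its maximum only at its end, so the axis is reached only there. -/
lemma IsCutPaste.isNegativeExcursion {φ ψ : List Piece} (h : IsCutPaste φ ψ)
    (hφ : StaysAbove φ) (h1 : height φ = 1) : IsNegativeExcursion ψ := by
  cases h with
  | switch hm =>
    refine ⟨by simp, by simp [height_map_switch hm, h1, Piece.step], ?_⟩
    intro a ha hne hne'
    rcases List.prefix_concat_iff.1 ha with rfl | ha
    · exact absurd rfl hne'
    · obtain ⟨b, hb, rfl⟩ := (List.prefix_map_iff (f := PatternTree.switch)).1 ha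
      have := hφ b hb (by rintro rfl; exact hne rfl)
      rw [height_map_switch fun h => hm (hb.subset h)]
      omega
  | @paste β α hm hβ hα =>
    rw [height_append] at h1
    refine ⟨by simp, by simp [Piece.step]; omega, ?_⟩
    intro a ha hne hne'
    rcases List.prefix_cons_iff.1 ha with rfl | ⟨t, rfl, ht⟩
    · exact absurd rfl hne
    · rw [height_cons, Piece.step]
      rcases prefix_append_iff.1 ht with ht | ⟨c, hc, rfl⟩
      · have := hα t ht; omega
      · have := hβ c hc (by rintro rfl; exact hne' rfl)
        rw [height_append]; omega

lemma StaysAbove.left {a b : List Piece} (h : StaysAbove (a ++ b)) : StaysAbove a :=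
  fun c hc => h c (hc.trans (List.prefix_append _ _))

/-- The final height `1` is the least integer strictly above the axis, so no point of `α` is lower
than its end. -/
lemma lowest_of_staysAbove {β α a : List Piece} (h : StaysAbove (β ++ α)) (hβ : β ≠ [])
    (h1 : height (β ++ α) = 1) (ha : a <+: α) : height α ≤ height a := by
  have := h (β ++ a) ((List.prefix_append_right_inj β).2 ha) (by simp [hβ])
  simp only [height_append] at this h1; omega

lemma ne_nil_of_highest {β α : List Piece} (hα : ∀ a, a <+: α → height a ≤ 0)
    (h1 : height (β ++ α) = 1) : β ≠ [] := by
  rintro rfl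
  have := hα α (List.prefix_refl _)
  rw [List.nil_append] at h1; omega

/-- Uniqueness of the rightmost lowest point: a nonempty `c` would have to be both nonincreasing
overall and strictly climbing. -/
lemma eq_nil_of_append_lowest {α c β : List Piece} (hlow : ∀ a, a <+: α ++ c →
    height (α ++ c) ≤ height a) (hβ : StaysAbove (c ++ β)) : c = [] := by
  by_contra hc
  have h1 := hlow α (List.prefix_append _ _)
  have h2 := hβ c (List.prefix_append _ _) hc
  rw [height_append] at h1; omega

/-- The presence of marks decides which action was used. Reflection is an involution; for a paste,
the junction must be the rightmost lowest point after the leading fall. -/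
lemma IsCutPaste.inj {φ φ' ψ : List Piece} (h : IsCutPaste φ ψ) (h' : IsCutPaste φ' ψ)
    (hφ : StaysAbove φ) (hφ' : StaysAbove φ') (h1 : height φ = 1) (h1' : height φ' = 1) :
    φ = φ' := by
  have hiff : Piece.marked ∈ φ ↔ Piece.marked ∈ φ' := by
    rw [← h.marked_mem_iff, ← h'.marked_mem_iff]
  generalize hψ : ψ = ψ' at h'
  cases h with
  | switch hm =>
    cases h' with
    | switch hm' =>
      have := List.append_cancel_right hψ
      exact (List.map_injective_iff.2
        (Function.LeftInverse.injective switch_switch)) this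
    | paste hm' _ _ => exact absurd (hiff.2 hm') hm
  | @paste β α hm hβ hα =>
    cases h' with
    | switch hm' => exact absurd (hiff.1 hm) hm'
    | @paste β' α' hm' hβ' hα' =>
      have hne := ne_nil_of_highest hα h1
      have hne' := ne_nil_of_highest hα' h1'
      rw [List.cons.injEq] at hψ
      rcases List.append_eq_append_iff.1 hψ.2 with ⟨c, rfl, rfl⟩ | ⟨c, rfl, rfl⟩
      · obtain rfl := eq_nil_of_append_lowest
          (fun a ha => lowest_of_staysAbove hφ' hne' h1' ha) hφ.left
        simp
      · obtain rfl := eq_nil_of_append_lowest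
          (fun a ha => lowest_of_staysAbove hφ hne h1 ha) hφ'.left
        simp

/-- This is the inverse action: reflect if there is no mark; otherwise delete the leading fall, cut
at the rightmost lowest point and exchange the two parts. -/
lemma exists_isCutPaste_eq {τ : List Piece} (hτ : StaysBelow τ) (h1 : height τ = -1) {p : Piece}
    (hp : p.step = 1) :
    ∃ φ, StaysAbove φ ∧ height φ = 1 ∧ IsCutPaste φ (τ ++ [p]) := by
  by_cases hm : Piece.marked ∈ τ ++ [p]
  · obtain ⟨q, γ, rfl⟩ : ∃ q γ, τ = q :: γ :=
      List.exists_cons_of_ne_nil (by rintro rfl; simp at h1)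
    have hq : q = Piece.fall := by
      have := hτ [q] (by simp) (by simp)
      cases q <;> simp_all [Piece.step]
    subst hq
    have hlow : ∀ a, a <+: γ → height a ≤ 0 := by
      intro a ha
      have := hτ (Piece.fall :: a) (by simpa using ha) (by simp)
      rw [height_cons, Piece.step] at this; omega
    have h0 : height (γ ++ [p]) = 1 := by
      simp only [height_cons, Piece.step] at h1
      simp only [height_append, height_cons, height_nil, hp]; omega
    obtain ⟨α, β, hαβ, hα, hβ⟩ := exists_cut_last_lowest (γ ++ [p])
    rw [hαβ] at h0
    -- The lowest height is at most `0`, while the whole path ends at `1`.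
    have hne : β ≠ [] := by
      rintro rfl
      have := hα [] (List.nil_prefix)
      simp at this h0; omega
    -- Only the endpoint reaches height `1`. This makes the end of `β` the strict first maximum once
    -- the parts are exchanged.
    have hpre : ∀ c, c <+: α ++ β → c ≠ α ++ β → height c ≤ 0 := by
      intro c hc hcne
      rw [← hαβ] at hc hcne
      rcases List.prefix_concat_iff.1 hc with rfl | hc
      · exact absurd rfl hcne
      · exact hlow c hc
    rw [height_append] at h0
    have hm' : Piece.marked ∈ β ++ α := by
      rw [List.cons_append, hαβ] at hm
      simpa [or_comm] using hm
    refine ⟨β ++ α, ?_, by rw [height_append]; omega, ?_⟩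
    · intro a ha hane
      rcases prefix_append_iff.1 ha with ha | ⟨c, hc, rfl⟩
      · exact hβ a ha hane
      · have := hα c hc
        rw [height_append]; omega
    · rw [List.cons_append, hαβ]
      refine .paste hm' (fun b hb hbne => ?_) fun a ha => ?_
      · have := hpre (α ++ b) ((List.prefix_append_right_inj α).2 hb) (by simpa using hbne)
        rw [height_append] at this; omega
      · refine hpre a (ha.trans (List.prefix_append _ _)) fun h => hne ?_
        have := ha.length_le
        rw [h, List.length_append] at this
        exact List.length_eq_zero_iff.1 (by omega)
  · have hτm : Piece.marked ∉ τ := fun h => hm (by simp [h])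
    have hp' : p = Piece.rise := by
      cases p <;> simp_all [Piece.step]
    subst hp'
    have hτm' : Piece.marked ∉ τ.map switch := by rwa [marked_mem_map_switch]
    refine ⟨τ.map switch, ?_, by rw [height_map_switch hτm]; omega, ?_⟩
    · intro a ha hne
      obtain ⟨b, hb, rfl⟩ := List.prefix_map_iff.1 ha
      have := hτ b hb (by rintro rfl; exact hne rfl)
      rw [height_map_switch fun h => hτm (hb.subset h)]
      omega
    · have := IsCutPaste.switch hτm'
      rwa [List.map_map, show switch ∘ switch = id from funext switch_switch,
        List.map_id] at this

lemma exists_decomposition {ω : List Piece} (h : height ω = 1) :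
    ∃ v φ ψ, ω = v ++ φ ∧ height v = 0 ∧ StaysAbove φ ∧ height φ = 1 ∧ IsCutPaste φ ψ ∧
      ∀ j, cutPaste j ω = v ++ ψ := by
  obtain ⟨v, φ, rfl, hv, hφ⟩ := exists_last_axis_above ω (by omega)
  obtain ⟨ψ, hψ⟩ := exists_isCutPaste φ
  rw [height_append, hv, zero_add] at h
  exact ⟨v, φ, ψ, rfl, hv, hφ, h, hψ, fun j => hψ.cutPaste_eq j hv hφ⟩

lemma cutPaste_injOn (j : ℕ) {ω ω' : List Piece} (h : height ω = 1) (h' : height ω' = 1)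
    (he : cutPaste j ω = cutPaste j ω') : ω = ω' := by
  obtain ⟨v, φ, ψ, rfl, hv, hφ, h1, hψ, hc⟩ := exists_decomposition h
  obtain ⟨v', φ', ψ', rfl, hv', hφ', h1', hψ', hc'⟩ := exists_decomposition h'
  rw [hc, hc'] at he
  obtain ⟨rfl, rfl⟩ := (hψ.isNegativeExcursion hφ h1).append_inj
    (hψ'.isNegativeExcursion hφ' h1') hv hv' he
  rw [hψ.inj hψ' hφ hφ' h1 h1']

lemma exists_cutPaste_eq (j : ℕ) {ω : List Piece} (h : height ω = -1) {p : Piece}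
    (hp : p.step = 1) : ∃ ω', height ω' = 1 ∧ cutPaste j ω' = ω ++ [p] := by
  obtain ⟨v, τ, rfl, hv, hτ⟩ := exists_last_axis_below ω (by omega)
  rw [height_append, hv, zero_add] at h
  obtain ⟨φ, hφ, h1, hc⟩ := exists_isCutPaste_eq hτ h hp
  exact ⟨v ++ φ, by simp [hv, h1], by rw [hc.cutPaste_eq j hv hφ, List.append_assoc]⟩

/-! ### Piece counts and final step after cut and paste. -/

lemma count_rise_map_switch (φ : List Piece) :
    (φ.map switch).count Piece.rise = φ.count Piece.fall := by
  induction φ with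
  | nil => rfl
  | cons p φ ih => cases p <;> simp [switch, ih]

lemma height_eq_count (φ : List Piece) : height φ =
    φ.count Piece.rise + φ.count Piece.marked - φ.count Piece.fall := by
  induction φ with
  | nil => rfl
  | cons p φ ih => cases p <;> simp [ih, Piece.step] <;> ring

lemma count_marked_cutPaste (j : ℕ) {ω : List Piece} (h : height ω = 1) :
    (cutPaste j ω).count Piece.marked = ω.count Piece.marked := by
  obtain ⟨v, φ, ψ, rfl, hv, hφ, h1, hψ, hc⟩ := exists_decomposition h
  rw [hc, List.count_append, List.count_append]
  congr 1
  cases hψ with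
  | switch hm =>
    rw [List.count_append, List.count_eq_zero_of_not_mem hm,
      List.count_eq_zero_of_not_mem (by rwa [marked_mem_map_switch])]
    simp
  | paste hm hβ hα => simp [add_comm]

lemma count_rise_cutPaste (j : ℕ) {ω : List Piece} (h : height ω = 1) :
    (cutPaste j ω).count Piece.rise = ω.count Piece.rise := by
  obtain ⟨v, φ, ψ, rfl, hv, hφ, h1, hψ, hc⟩ := exists_decomposition h
  rw [hc, List.count_append, List.count_append]
  congr 1
  cases hψ with
  | switch hm =>
    -- An unmarked `φ` of height `1` has one more rise than falls; the appended rise makes up for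
    -- the one lost in the reflection.
    rw [height_eq_count, List.count_eq_zero_of_not_mem hm] at h1
    rw [List.count_append, count_rise_map_switch]
    simp; omega
  | paste hm hβ hα => simp [add_comm]

/-- The result of the cut and paste actions ends on the axis, with a piece that is not a fall
step. -/
lemma cutPaste_shape (j : ℕ) {ω : List Piece} (h : height ω = 1) :
    ∃ τ p, cutPaste j ω = τ ++ [p] ∧ p.step = 1 ∧ height τ = -1 := by
  obtain ⟨v, φ, ψ, rfl, hv, hφ, h1, hψ, hc⟩ := exists_decomposition h
  have hex := hψ.isNegativeExcursion hφ h1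
  obtain ⟨τ, p, rfl⟩ : ∃ τ p, ψ = τ ++ [p] :=
    ⟨_, _, (List.dropLast_append_getLast hex.ne_nil).symm⟩
  have h0 := hex.height_eq
  have hp : p.step = 1 := by
    rcases step_eq p with hp | hp
    · exact hp
    -- A final fall onto the axis would come from height `1`, which a negative excursion never
    -- visits.
    · simp [hp] at h0
      have hτ : τ ≠ [] := by rintro rfl; simp at h0
      have := hex.height_lt τ (List.prefix_append _ _) hτ (by simp)
      omega
  refine ⟨v ++ τ, p, by rw [hc, List.append_assoc], hp, ?_⟩
  simp [hp] at h0
  rw [height_append]; omega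

/-! ### The sons of a path -/

/-- The path followed by the piece of a production and `m` fall steps. -/
def extend (p : Production) (m : ℕ) (ω : List Piece) : List Piece :=
  ω ++ p.piece :: List.replicate m Piece.fall

lemma step_piece (p : Production) : p.piece.step = 1 := by cases p <;> rfl

lemma piece_ne_fall (p : Production) : p.piece ≠ Piece.fall := by cases p <;> simp [Production.piece]

lemma height_extend (p : Production) (m : ℕ) (ω : List Piece) :
    height (extend p m ω) = height ω + 1 - m := by
  simp [extend, step_piece]; ring

lemma count_rise_extend (p : Production) (m : ℕ) (ω : List Piece) :
    (extend p m ω).count Piece.rise = ω.count Piece.rise + if p.marks then 0 else 1 := by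
  cases p <;> simp [extend, List.count_replicate, Production.piece, Production.marks]

lemma count_marked_extend (p : Production) (m : ℕ) (ω : List Piece) :
    (extend p m ω).count Piece.marked = ω.count Piece.marked + if p.marks then 1 else 0 := by
  cases p <;> simp [extend, List.count_replicate, Production.piece, Production.marks]

lemma replicate_append_cons_inj {α : Type*} {a p p' : α} (hp : p ≠ a) (hp' : p' ≠ a) {m m' : ℕ}
    {l l' : List α} (h : List.replicate m a ++ p :: l = List.replicate m' a ++ p' :: l') :
    m = m' ∧ p = p' ∧ l = l' := by
  induction m generalizing m' with
  | zero =>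
    cases m' with
    | zero => simpa using h
    | succ m' => simp [List.replicate_succ, hp] at h
  | succ m ih =>
    cases m' with
    | zero => simp [List.replicate_succ, hp'.symm] at h
    | succ m' =>
      simp only [List.replicate_succ, List.cons_append, List.cons.injEq, true_and] at h
      simpa using ih h

/-- The added piece is the last one that is not a fall, so reading from the right recovers all the
data. -/
lemma extend_inj {p p' : Production} {m m' : ℕ} {ω ω' : List Piece}
    (h : extend p m ω = extend p' m' ω') : p = p' ∧ m = m' ∧ ω = ω' := by
  have h' := congrArg List.reverse h
  simp only [extend, List.reverse_append, List.reverse_cons, List.reverse_replicate,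
    List.append_assoc, List.singleton_append] at h'
  obtain ⟨hm, hp, hω⟩ := replicate_append_cons_inj (piece_ne_fall p) (piece_ne_fall p') h'
  refine ⟨?_, hm, List.reverse_injective hω⟩
  cases p <;> cases p' <;> simp_all [Production.piece]

lemma exists_eq_extend {ω : List Piece} (hne : ω ≠ []) (h : 0 ≤ height ω) :
    ∃ p m ω', ω = extend p m ω' := by
  induction ω using List.reverseRecOn with
  | nil => exact absurd rfl hne
  | append_singleton ω q ih =>
    cases q with
    | rise => exact ⟨.first, 0, ω, rfl⟩
    | marked => exact ⟨.second, 0, ω, rfl⟩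
    | fall =>
      simp [Piece.step] at h
      obtain ⟨p, m, ω', rfl⟩ := ih (by rintro rfl; simp at h) (by omega)
      exact ⟨p, m + 1, ω', by simp [extend, List.replicate_succ']⟩

lemma num_mem_ruleSons {k h : ℕ} : Label.num h ∈ ruleSons k ↔ 1 ≤ h ∧ h ≤ k + 1 := by
  simp only [ruleSons, List.mem_cons, reduceCtorEq, List.mem_map, List.mem_range, Label.num.injEq,
    false_or]
  constructor
  · rintro ⟨a, ha, rfl⟩; omega
  · rintro ⟨h1, h2⟩; exact ⟨h - 1, by omega, by omega⟩

lemma zeroOne_mem_ruleSons (k : ℕ) : Label.zeroOne ∈ ruleSons k := by simp [ruleSons]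

lemma zeroTwo_mem_ruleSons (k : ℕ) : Label.zeroTwo ∈ ruleSons k := by simp [ruleSons]

lemma value_le_of_mem_ruleSons {l : Label} {k : ℕ} (hl : l ∈ ruleSons k) : l.value ≤ k + 1 := by
  cases l with
  | num h => exact (num_mem_ruleSons.1 hl).2
  | zeroOne => simp [Label.value]
  | zeroTwo => simp [Label.value]

lemma eq_of_value_eq {l l' : Label} {k k' : ℕ} (hl : l ∈ ruleSons k) (hl' : l' ∈ ruleSons k')
    (h1 : l ≠ Label.zeroOne) (h1' : l' ≠ Label.zeroOne) (h : l.value = l'.value) : l = l' := by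
  cases l <;> cases l' <;> simp_all [Label.value, num_mem_ruleSons]; omega

lemma construct_zeroOne (j : ℕ) (p : Production) (ω : List Piece) :
    construct j p .zeroOne ω = cutPaste j (extend p (height ω).toNat ω) := by
  simp [construct, ordinate_word, extend]

lemma construct_of_ne (j : ℕ) (p : Production) {l : Label} (hl : l ≠ Label.zeroOne)
    (ω : List Piece) :
    construct j p l ω = extend p ((height ω).toNat + 1 - l.value) ω := by
  cases l <;> simp_all [construct, ordinate_word, extend, Label.value]

lemma height_extend_toNat (p : Production) {ω : List Piece} (h : 0 ≤ height ω) :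
    height (extend p (height ω).toNat ω) = 1 := by
  rw [height_extend]; omega

lemma height_construct (j : ℕ) (p : Production) {l : Label} {ω : List Piece} (h : 0 ≤ height ω)
    (hl : l ∈ ruleSons (height ω).toNat) : height (construct j p l ω) = l.value := by
  by_cases h1 : l = Label.zeroOne
  · subst h1
    obtain ⟨τ, q, hc, hq, hτ⟩ := cutPaste_shape j (height_extend_toNat p h)
    rw [construct_zeroOne, hc]
    simp [hq, hτ, Label.value]
  · have := value_le_of_mem_ruleSons hl
    rw [construct_of_ne j p h1, height_extend]; omega

lemma count_marked_construct (j : ℕ) (p : Production) (l : Label) {ω : List Piece}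
    (h : 0 ≤ height ω) : (construct j p l ω).count Piece.marked =
      ω.count Piece.marked + if p.marks then 1 else 0 := by
  by_cases h1 : l = Label.zeroOne
  · subst h1
    rw [construct_zeroOne, count_marked_cutPaste j (height_extend_toNat p h), count_marked_extend]
  · rw [construct_of_ne j p h1, count_marked_extend]

lemma count_rise_construct (j : ℕ) (p : Production) (l : Label) {ω : List Piece}
    (h : 0 ≤ height ω) : (construct j p l ω).count Piece.rise =
      ω.count Piece.rise + if p.marks then 0 else 1 := by
  by_cases h1 : l = Label.zeroOne
  · subst h1
    rw [construct_zeroOne, count_rise_cutPaste j (height_extend_toNat p h), count_rise_extend]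
  · rw [construct_of_ne j p h1, count_rise_extend]

lemma count_true_word (j : ℕ) (ω : List Piece) : (word j ω).count true =
    ω.count Piece.rise + (j + 1) * ω.count Piece.marked := by
  induction ω with
  | nil => rfl
  | cons p ω ih =>
    rw [word_cons, List.count_append, ih]
    cases p <;> simp [Piece.word, pattern, List.count_replicate] <;> ring

lemma count_true_construct (j : ℕ) (p : Production) (l : Label) {ω : List Piece}
    (h : 0 ≤ height ω) : (word j (construct j p l ω)).count true =
      p.jump j + (word j ω).count true := by
  rw [count_true_word, count_true_word, count_rise_construct j p l h,
    count_marked_construct j p l h]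
  cases p <;> simp [Production.jump, Production.marks] <;> ring

/-- This separates the two sons of value `0`: the one for `(0₂)` ends with a fall, the one for
`(0₁)` does not. -/
lemma extend_ne_append {p : Production} {m : ℕ} {ω τ : List Piece} {q : Piece} (hq : q.step = 1) :
    extend p (m + 1) ω ≠ τ ++ [q] := by
  intro h
  rw [extend, List.replicate_succ', ← List.cons_append, ← List.append_assoc] at h
  have := (List.append_inj' h rfl).2
  simp at this
  subst this
  simp [Piece.step] at hq

lemma construct_inj {j : ℕ} {p p' : Production} {l l' : Label} {ω ω' : List Piece}
    (h : 0 ≤ height ω) (h' : 0 ≤ height ω') (hl : l ∈ ruleSons (height ω).toNat)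
    (hl' : l' ∈ ruleSons (height ω').toNat) (he : construct j p l ω = construct j p' l' ω') :
    p = p' ∧ l = l' ∧ ω = ω' := by
  have hval : l.value = l'.value := by
    have h1 := height_construct j p h hl
    rw [he, height_construct j p' h' hl'] at h1
    omega
  by_cases h1 : l = Label.zeroOne <;> by_cases h1' : l' = Label.zeroOne
  · subst h1 h1'
    rw [construct_zeroOne, construct_zeroOne] at he
    obtain ⟨hp, -, hω⟩ := extend_inj (cutPaste_injOn j (height_extend_toNat p h)
      (height_extend_toNat p' h') he)
    exact ⟨hp, rfl, hω⟩
  · subst h1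
    obtain ⟨τ, q, hc, hq, -⟩ := cutPaste_shape j (height_extend_toNat p h)
    rw [construct_zeroOne, construct_of_ne j p' h1', ← hval, hc] at he
    exact absurd he.symm (extend_ne_append hq)
  · subst h1'
    obtain ⟨τ, q, hc, hq, -⟩ := cutPaste_shape j (height_extend_toNat p' h')
    rw [construct_zeroOne, construct_of_ne j p h1, hval, hc] at he
    exact absurd he (extend_ne_append hq)
  · rw [construct_of_ne j p h1, construct_of_ne j p' h1'] at he
    obtain ⟨hp, -, hω⟩ := extend_inj he
    exact ⟨hp, eq_of_value_eq hl hl' h1 h1' hval, hω⟩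

lemma exists_construct_eq (j : ℕ) {ω : List Piece} (hne : ω ≠ []) (h : 0 ≤ height ω) :
    ∃ p l ω', 0 ≤ height ω' ∧ l ∈ ruleSons (height ω').toNat ∧ ω = construct j p l ω' := by
  obtain ⟨p, m, τ, rfl⟩ := exists_eq_extend hne h
  rw [height_extend] at h
  by_cases hτ : 0 ≤ height τ
  · obtain ⟨l, hl, h1, hv⟩ : ∃ l, l ∈ ruleSons (height τ).toNat ∧ l ≠ Label.zeroOne ∧
        l.value = (height τ).toNat + 1 - m := by
      -- Without cut and paste, the value `0` can come only from `(0₂)`.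
      by_cases h0 : (height τ).toNat + 1 - m = 0
      · exact ⟨.zeroTwo, zeroTwo_mem_ruleSons _, by simp, h0.symm⟩
      · exact ⟨.num _, num_mem_ruleSons.2 ⟨by omega, Nat.sub_le _ m⟩, by simp, rfl⟩
    refine ⟨p, l, τ, hτ, hl, ?_⟩
    rw [construct_of_ne j p h1, hv]
    congr 1; omega
  -- A nonnegative final height with `height τ < 0` forces `height τ = -1` and `m = 0`.
  · obtain rfl : m = 0 := by omega
    obtain ⟨ω₁, h1, hc⟩ := exists_cutPaste_eq j (ω := τ) (by omega) (step_piece p)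
    -- The production is read off the path before cut and paste. It may differ from `p`, since the
    -- pieces have been rearranged.
    obtain ⟨p', m', ω', rfl⟩ := exists_eq_extend (ω := ω₁) (by rintro rfl; simp at h1) (by omega)
    rw [height_extend] at h1
    refine ⟨p', .zeroOne, ω', by omega, zeroOne_mem_ruleSons _, ?_⟩
    rw [construct_zeroOne, show (height ω').toNat = m' by omega, hc]
    rfl

lemma construct_ne_nil {j : ℕ} {p : Production} {l : Label} {ω : List Piece}
    (h : 0 ≤ height ω) : construct j p l ω ≠ [] := by
  intro he
  have := count_true_construct j p l h
  rw [he] at this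
  cases p <;> simp [Production.jump] at this <;> omega

/-! ### The trees -/

lemma inF_word_iff {j : ℕ} {ω : List Piece} : InF (word j ω) ↔ 0 ≤ height ω := by
  rw [inF_iff, ordinate_word]

/-- The path generated by a code. -/
def pathOf (j : ℕ) : List (Production × Label) → List Piece
  | [] => []
  | e :: c => construct j e.1 e.2 (pathOf j c)

lemma height_pathOf (j : ℕ) {c : List (Production × Label)} (hc : IsCode c) :
    height (pathOf j c) = codeValue c := by
  induction c with
  | nil => rfl
  | cons e c ih =>
    obtain ⟨he, hc⟩ := hc
    have := ih hc
    rw [pathOf, height_construct j _ (by omega) (by rwa [this, Int.toNat_natCast])]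
    rfl

lemma height_pathOf_nonneg (j : ℕ) {c : List (Production × Label)} (hc : IsCode c) :
    0 ≤ height (pathOf j c) := by rw [height_pathOf j hc]; omega

lemma mem_ruleSons_pathOf {j : ℕ} {c : List (Production × Label)} (hc : IsCode c) {l : Label} :
    l ∈ ruleSons (height (pathOf j c)).toNat ↔ l ∈ ruleSons (codeValue c) := by
  rw [height_pathOf j hc, Int.toNat_natCast]

lemma pathOf_injective (j : ℕ) {c c' : List (Production × Label)} (hc : IsCode c)
    (hc' : IsCode c') (h : pathOf j c = pathOf j c') : c = c' := by
  induction c generalizing c' with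
  | nil =>
    cases c' with
    | nil => rfl
    | cons e' c' => exact absurd h.symm (construct_ne_nil (height_pathOf_nonneg j hc'.2))
  | cons e c ih =>
    cases c' with
    | nil => exact absurd h (construct_ne_nil (height_pathOf_nonneg j hc.2))
    | cons e' c' =>
      obtain ⟨hp, hl, hω⟩ := construct_inj (height_pathOf_nonneg j hc.2)
        (height_pathOf_nonneg j hc'.2) ((mem_ruleSons_pathOf hc.2).2 hc.1)
        ((mem_ruleSons_pathOf hc'.2).2 hc'.1) h
      rw [ih hc.2 hc'.2 hω, Prod.ext hp hl]

lemma exists_pathOf_eq (j : ℕ) (ω : List Piece) (h : 0 ≤ height ω) :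
    ∃ c, IsCode c ∧ pathOf j c = ω := by
  -- Passing to the parent removes at least one rise step, so the number of ones is a measure of
  -- descent.
  induction hn : (word j ω).count true using Nat.strong_induction_on generalizing ω with
  | _ n ih =>
  subst hn
  by_cases hne : ω = []
  · exact ⟨[], trivial, hne.symm⟩
  · obtain ⟨p, l, ω', h', hl, rfl⟩ := exists_construct_eq j hne h
    obtain ⟨c, hc, rfl⟩ := ih _ (by
      rw [count_true_construct j p l h']
      cases p <;> simp [Production.jump]) ω' h' rfl
    exact ⟨(p, l) :: c, ⟨(mem_ruleSons_pathOf hc).1 hl, hc⟩, rfl⟩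

lemma codeLevel_eq (j : ℕ) {c : List (Production × Label)} (hc : IsCode c) :
    codeLevel j c = (word j (pathOf j c)).count true := by
  induction c with
  | nil => rfl
  | cons e c ih =>
    rw [pathOf, count_true_construct j _ _ (height_pathOf_nonneg j hc.2), ← ih hc.2]
    simp [codeLevel]

lemma codeMarked_eq (j : ℕ) {c : List (Production × Label)} (hc : IsCode c) :
    codeMarked c = decide (Odd ((pathOf j c).count Piece.marked)) := by
  induction c with
  | nil => simp [codeMarked, pathOf]
  | cons e c ih =>
    rw [pathOf, count_marked_construct j _ _ (height_pathOf_nonneg j hc.2), codeMarked, ih hc.2]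
    cases e.1.marks <;> simp [Nat.odd_add_one, -Nat.not_odd_iff_even]

/-- The path generated by a node of the tree of the rule, as a node of the tree of paths. -/
def pathNode (j : ℕ) (c : (ruleTree j).Node) : (pathTree j).Node :=
  ⟨pathOf j c.1, inF_word_iff.2 (height_pathOf_nonneg j c.2)⟩

lemma pathNode_bijective (j : ℕ) : Function.Bijective (pathNode j) := by
  refine ⟨fun c c' h => Subtype.ext (pathOf_injective j c.2 c'.2 (congrArg Subtype.val h)),
    fun ω => ?_⟩
  obtain ⟨c, hc, h⟩ := exists_pathOf_eq j ω.1 (inF_word_iff.1 ω.2)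
  exact ⟨⟨c, hc⟩, Subtype.ext h⟩

/-- The isomorphism of the tree of the rule and the tree of paths. -/
noncomputable def treeIso (j : ℕ) : (ruleTree j).Iso (pathTree j) where
  toEquiv := Equiv.ofBijective (pathNode j) (pathNode_bijective j)
  map_root := rfl
  map_son p l x y := by
    change (l ∈ ruleSons (ordinate (word j (pathOf j x.1))).toNat ∧
      pathOf j y.1 = construct j p l (pathOf j x.1)) ↔ y.1 = (p, l) :: x.1
    rw [ordinate_word, mem_ruleSons_pathOf x.2]
    constructor
    · rintro ⟨hl, h⟩
      exact pathOf_injective j (c' := (p, l) :: x.1) y.2 ⟨hl, x.2⟩ h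
    · intro h
      have hy : IsCode y.1 := y.2
      rw [h] at hy ⊢
      exact ⟨hy.1, rfl⟩
  map_level x := (codeLevel_eq j x.2).symm
  map_value x := by
    change (ordinate (word j (pathOf j x.1))).toNat = codeValue x.1
    rw [ordinate_word, height_pathOf j x.2, Int.toNat_natCast]
  map_marked x := (codeMarked_eq j x.2).symm

lemma ruleTree_isRootedTree (j : ℕ) : (ruleTree j).IsRootedTree := by
  refine ⟨fun p l x h => List.cons_ne_nil _ _ (Eq.symm h), ?_, ?_⟩
  · rintro ⟨c, hc⟩ hne
    cases c with
    | nil => exact absurd rfl hne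
    | cons e c =>
      refine ⟨(e.1, e.2, ⟨c, hc.2⟩), rfl, ?_⟩
      rintro ⟨p, l, x, hx⟩ h
      obtain ⟨rfl, rfl⟩ := List.cons.inj h
      rfl
  · rintro ⟨c, hc⟩
    induction c with
    | nil => exact .refl
    | cons e c ih => exact (ih hc.2).tail ⟨e.1, e.2, rfl⟩

lemma LabelledDigraph.Iso.isRootedTree {T U : LabelledDigraph} (e : T.Iso U)
    (h : T.IsRootedTree) : U.IsRootedTree := by
  obtain ⟨h1, h2, h3⟩ := h
  refine ⟨fun p l x hx => ?_, fun y hy => ?_, fun y => ?_⟩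
  · obtain ⟨x, rfl⟩ := e.toEquiv.surjective x
    rw [← e.map_root, e.map_son] at hx
    exact h1 p l x hx
  · obtain ⟨y, rfl⟩ := e.toEquiv.surjective y
    obtain ⟨⟨p, l, x⟩, hx, huniq⟩ := h2 y (by rintro rfl; exact hy e.map_root)
    refine ⟨(p, l, e.toEquiv x), (e.map_son _ _ _ _).2 hx, ?_⟩
    rintro ⟨p', l', x'⟩ hx'
    obtain ⟨x', rfl⟩ := e.toEquiv.surjective x'
    have := huniq (p', l', x') ((e.map_son _ _ _ _).1 hx')
    simp only [Prod.mk.injEq] at this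
    obtain ⟨rfl, rfl, rfl⟩ := this
    rfl
  · obtain ⟨y, rfl⟩ := e.toEquiv.surjective y
    rw [← e.map_root]
    refine Relation.ReflTransGen.lift e.toEquiv ?_ _ _ (h3 y)
    rintro x x' ⟨p, l, hx⟩
    exact ⟨p, l, (e.map_son _ _ _ _).2 hx⟩

/-! ### Marked paths and words with chosen occurrences -/

lemma mem_markedPositions {j : ℕ} {ω : List Piece} {i : ℕ} : i ∈ markedPositions j ω ↔
    ∃ a b, ω = a ++ Piece.marked :: b ∧ (word j a).length = i := by
  simp only [markedPositions, Finset.mem_image, Finset.mem_filter, Finset.mem_range]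
  constructor
  · rintro ⟨n, ⟨hn, hn'⟩, rfl⟩
    rw [List.getElem?_eq_getElem hn, Option.some.injEq] at hn'
    exact ⟨ω.take n, ω.drop (n + 1), by rw [← hn', List.cons_getElem_drop_succ,
      List.take_append_drop], rfl⟩
  · rintro ⟨a, b, rfl, rfl⟩
    exact ⟨a.length, by simp, by simp⟩

@[simp] lemma markedPositions_nil (j : ℕ) : markedPositions j [] = ∅ := by
  ext; simp [mem_markedPositions]

lemma mem_markedPositions_cons {j : ℕ} {p : Piece} {ω : List Piece} {i : ℕ} :
    i ∈ markedPositions j (p :: ω) ↔ (p = Piece.marked ∧ i = 0) ∨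
      ∃ i' ∈ markedPositions j ω, i = (p.word j).length + i' := by
  simp only [mem_markedPositions]
  constructor
  · rintro ⟨a, b, h, rfl⟩
    cases a with
    | nil => simp at h; simp [h]
    | cons q a =>
      simp only [List.cons_append, List.cons.injEq] at h
      obtain ⟨rfl, rfl⟩ := h
      exact Or.inr ⟨_, ⟨a, b, rfl, rfl⟩, by simp⟩
  · rintro (⟨rfl, rfl⟩ | ⟨i', ⟨a, b, rfl, rfl⟩, rfl⟩)
    · exact ⟨[], ω, rfl, rfl⟩
    · exact ⟨p :: a, b, rfl, by simp⟩

lemma length_pattern (j : ℕ) : (pattern j).length = 2 * j + 1 := by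
  simp [pattern]; omega

lemma length_word_pos (j : ℕ) (p : Piece) : 0 < (p.word j).length := by
  cases p <;> simp [Piece.word, length_pattern]

lemma zero_mem_markedPositions_cons {j : ℕ} {p : Piece} {ω : List Piece} :
    0 ∈ markedPositions j (p :: ω) ↔ p = Piece.marked := by
  rw [mem_markedPositions_cons]
  have := length_word_pos j p
  constructor
  · rintro (h | ⟨i', -, h⟩)
    · exact h.1
    · omega
  · exact fun h => Or.inl ⟨h, rfl⟩

lemma add_mem_markedPositions_cons {j : ℕ} {p : Piece} {ω : List Piece} {i : ℕ} :
    (p.word j).length + i ∈ markedPositions j (p :: ω) ↔ i ∈ markedPositions j ω := by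
  rw [mem_markedPositions_cons]
  have := length_word_pos j p
  constructor
  · rintro (h | ⟨i', hi', h⟩)
    · omega
    · rwa [show i = i' by omega]
  · exact fun h => Or.inr ⟨i, h, rfl⟩

lemma card_markedPositions (j : ℕ) (ω : List Piece) :
    (markedPositions j ω).card = ω.count Piece.marked := by
  induction ω with
  | nil => simp
  | cons p ω ih =>
    have himg : markedPositions j (p :: ω) = (if p = Piece.marked then {0} else ∅) ∪
        (markedPositions j ω).image fun i => (p.word j).length + i := by
      ext i
      rw [mem_markedPositions_cons, Finset.mem_union, Finset.mem_image]
      split_ifs with h <;> simp [h, eq_comm]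
    have hpos := length_word_pos j p
    rw [himg, Finset.card_union_of_disjoint, Finset.card_image_of_injective _
      (add_right_injective _), ih, List.count_cons]
    · cases p <;> simp [add_comm]
    · split_ifs
      · rw [Finset.disjoint_singleton_left, Finset.mem_image]
        rintro ⟨a, -, h⟩; omega
      · exact Finset.disjoint_empty_left _

lemma mem_occurrences {j : ℕ} {w : List Bool} {i : ℕ} :
    i ∈ occurrences j w ↔ pattern j <+: w.drop i := by
  rw [occurrences, Finset.mem_filter, Finset.mem_range, and_iff_right_iff_imp]
  intro h
  have := h.length_le
  rw [length_pattern, List.length_drop] at this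
  omega

lemma markedPositions_subset (j : ℕ) (ω : List Piece) :
    markedPositions j ω ⊆ occurrences j (word j ω) := by
  intro i hi
  obtain ⟨a, b, rfl, rfl⟩ := mem_markedPositions.1 hi
  rw [mem_occurrences, word_append, List.drop_left, word_cons]
  exact List.prefix_append _ _

lemma getElem?_pattern_drop {j : ℕ} {w : List Bool} {i k : ℕ} (h : pattern j <+: w.drop i)
    (hk : k < 2 * j + 1) : w[i + k]? = some (decide (k < j + 1)) := by
  obtain ⟨t, ht⟩ := h
  rw [← List.getElem?_drop, ← ht, List.getElem?_append_left (by rwa [length_pattern]), pattern]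
  by_cases hk' : k < j + 1
  · rw [List.getElem?_append_left (by simpa using hk')]
    simp [hk']
  · rw [List.getElem?_append_right (by simpa using hk')]
    simp [hk', List.getElem?_replicate]; omega

/-- Two occurrences of the pattern do not overlap. -/
lemma pattern_no_overlap {j : ℕ} {w : List Bool} {i : ℕ} (h0 : pattern j <+: w)
    (hi : pattern j <+: w.drop i) (hpos : 0 < i) : 2 * j + 1 ≤ i := by
  by_contra hlt
  replace h0 : pattern j <+: w.drop 0 := h0
  -- For a shift `i ≤ j`, the first zero of the first copy meets a one of the second. For a larger
  -- shift, the leading one of the second copy meets a zero of the first.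
  by_cases hij : i ≤ j
  · have h1 := getElem?_pattern_drop h0 (k := j + 1) (by omega)
    have h2 := getElem?_pattern_drop hi (k := j + 1 - i) (by omega)
    rw [show i + (j + 1 - i) = 0 + (j + 1) by omega, h1] at h2
    simp at h2; omega
  · have h1 := getElem?_pattern_drop h0 (k := i) (by omega)
    have h2 := getElem?_pattern_drop hi (k := 0) (by omega)
    rw [show i + 0 = 0 + i by omega, h1] at h2
    simp at h2; omega

lemma exists_piece_word_eq (j : ℕ) (b : Bool) : ∃ p : Piece, p ≠ Piece.marked ∧ p.word j = [b] := by
  cases b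
  · exact ⟨.fall, by simp, rfl⟩
  · exact ⟨.rise, by simp, rfl⟩

/-- The word is parsed from the left: a chosen occurrence at the start becomes one marked piece, any
other first letter a single step. Occurrences do not overlap, so the remaining choices lie beyond
the piece just read. -/
lemma exists_markedPositions_eq (j : ℕ) (w : List Bool) (S : Finset ℕ) (hS : S ⊆ occurrences j w) :
    ∃ ω, word j ω = w ∧ markedPositions j ω = S := by
  induction hn : w.length using Nat.strong_induction_on generalizing w S with
  | _ n ih =>
  subst hn
  have hocc : ∀ i ∈ S, pattern j <+: w.drop i := fun i hi => mem_occurrences.1 (hS hi)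
  by_cases hw : w = []
  · subst hw
    refine ⟨[], rfl, ?_⟩
    rw [markedPositions_nil, eq_comm, Finset.eq_empty_iff_forall_notMem]
    intro i hi
    have := (hocc i hi).length_le
    simp [length_pattern] at this
  · obtain ⟨p, w', rfl, hp, hgap⟩ : ∃ (p : Piece) (w' : List Bool), w = p.word j ++ w' ∧
        (p = Piece.marked ↔ 0 ∈ S) ∧ ∀ i ∈ S, 0 < i → (p.word j).length ≤ i := by
      by_cases h0 : 0 ∈ S
      · obtain ⟨w', hw'⟩ := hocc 0 h0
        refine ⟨.marked, w', hw'.symm, by simp [h0], fun i hi hpos => ?_⟩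
        rw [Piece.word, length_pattern]
        exact pattern_no_overlap (hocc 0 h0) (hocc i hi) hpos
      · obtain ⟨b, w', rfl⟩ := List.exists_cons_of_ne_nil hw
        obtain ⟨p, hpm, hp⟩ := exists_piece_word_eq j b
        exact ⟨p, w', by simp [hp], by simp [hpm, h0], fun i _ hpos => by simpa [hp] using Nat.succ_le_of_lt hpos⟩
    have hlen := length_word_pos j p
    obtain ⟨ω, rfl, hω⟩ := ih w'.length (by simp; omega) w'
      (S.preimage (fun i => (p.word j).length + i) (add_right_injective _).injOn) (by
        intro i hi
        have := hocc _ (Finset.mem_preimage.1 hi)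
        rwa [List.drop_length_add_append, ← mem_occurrences] at this) rfl
    refine ⟨p :: ω, by simp, ?_⟩
    ext i
    rw [mem_markedPositions_cons, hω]
    constructor
    · rintro (⟨h, rfl⟩ | ⟨i', hi', rfl⟩)
      · exact hp.1 h
      · exact Finset.mem_preimage.1 hi'
    · intro hi
      rcases Nat.eq_zero_or_pos i with rfl | hpos
      · exact Or.inl ⟨hp.2 hi, rfl⟩
      · obtain ⟨i', rfl⟩ := Nat.exists_eq_add_of_le (hgap i hi hpos)
        exact Or.inr ⟨i', Finset.mem_preimage.2 hi, rfl⟩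

lemma word_eq_nil {j : ℕ} {ω : List Piece} (h : word j ω = []) : ω = [] := by
  cases ω with
  | nil => rfl
  | cons p ω =>
    have := length_word_pos j p
    simp only [word_cons, List.append_eq_nil_iff] at h
    simp [h.1] at this

/-- The parse is forced: `0` is a marked position exactly when the first piece is marked, and
otherwise the first letter determines that piece. -/
lemma eq_of_word_eq_of_markedPositions_eq {j : ℕ} {ω ω' : List Piece}
    (hw : word j ω = word j ω') (hm : markedPositions j ω = markedPositions j ω') : ω = ω' := by
  induction ω generalizing ω' with
  | nil => exact (word_eq_nil hw.symm).symm
  | cons p ω ih =>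
    cases ω' with
    | nil => exact word_eq_nil hw
    | cons q ω' =>
      have hpq : p = Piece.marked ↔ q = Piece.marked := by
        rw [← zero_mem_markedPositions_cons (j := j), hm, zero_mem_markedPositions_cons]
      obtain rfl : p = q := by
        cases p <;> cases q <;> simp_all [Piece.word]
      rw [word_cons, word_cons] at hw
      rw [ih (List.append_cancel_left hw) ?_]
      ext i
      rw [← add_mem_markedPositions_cons, hm, add_mem_markedPositions_cons]

/-! ### Counting -/

instance : Finite Piece :=
  Finite.of_surjective ![Piece.rise, Piece.fall, Piece.marked] fun p => by
    cases p
    · exact ⟨0, rfl⟩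
    · exact ⟨1, rfl⟩
    · exact ⟨2, rfl⟩

lemma avoids_iff {j : ℕ} {w : List Bool} : Avoids j w ↔ occurrences j w = ∅ := by
  rw [Avoids, Finset.eq_empty_iff_forall_notMem, ← not_exists, not_iff_not]
  simp only [mem_occurrences]
  constructor
  · rintro ⟨s, t, rfl⟩
    exact ⟨s.length, by simp [List.append_assoc]⟩
  · rintro ⟨i, hi⟩
    exact hi.isInfix.trans (List.drop_suffix i w).isInfix

lemma length_le_length_word (j : ℕ) (ω : List Piece) : ω.length ≤ (word j ω).length := by
  induction ω with
  | nil => simp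
  | cons p ω ih =>
    have := length_word_pos j p
    simp; omega

lemma length_eq_count (w : List Bool) : w.length = w.count true + w.count false :=
  (List.count_true_add_count_false w).symm

lemma length_le_of_inF {w : List Bool} (h : InF w) : w.length ≤ 2 * w.count true := by
  unfold InF at h
  rw [length_eq_count]; omega

lemma finite_words (n : ℕ) : {w | InF w ∧ w.count true = n}.Finite := by
  refine (List.finite_length_le Bool (2 * n)).subset ?_
  rintro w ⟨hw, rfl⟩
  exact length_le_of_inF hw

/-! ### Consequences valid for every isomorphism of the two trees. -/

namespace LabelledDigraph.Iso

variable {j : ℕ} (e : (ruleTree j).Iso (pathTree j))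

lemma inF_word_path (c : (ruleTree j).Node) : InF (word j (e.path c)) := (e.toEquiv c).2

lemma path_injective : Function.Injective e.path :=
  Subtype.val_injective.comp e.toEquiv.injective

lemma exists_path_eq {w : List Bool} (hw : InF w) {S : Finset ℕ} (hS : S ⊆ occurrences j w) :
    ∃ c, word j (e.path c) = w ∧ markedPositions j (e.path c) = S := by
  obtain ⟨ω, rfl, rfl⟩ := exists_markedPositions_eq j w S hS
  obtain ⟨c, hc⟩ := e.toEquiv.surjective ⟨ω, hw⟩
  have hc' : e.path c = ω := congrArg Subtype.val hc
  exact ⟨c, by rw [hc'], by rw [hc']⟩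

lemma eq_of_word_eq {c c' : (ruleTree j).Node} (hw : word j (e.path c) = word j (e.path c'))
    (hm : markedPositions j (e.path c) = markedPositions j (e.path c')) : c = c' :=
  e.path_injective (eq_of_word_eq_of_markedPositions_eq hw hm)

lemma level_eq (c : (ruleTree j).Node) :
    (ruleTree j).level c = (word j (e.path c)).count true := (e.map_level c).symm

lemma value_eq (c : (ruleTree j).Node) :
    (ruleTree j).value c = (ordinate (word j (e.path c))).toNat := (e.map_value c).symm

lemma marked_iff (c : (ruleTree j).Node) :
    (ruleTree j).marked c = true ↔ Odd (markedPositions j (e.path c)).card := by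
  rw [← e.map_marked c, card_markedPositions]
  exact decide_eq_true_iff

lemma marked_eq (c : (ruleTree j).Node) :
    (ruleTree j).marked c = decide (Odd (markedPositions j (e.path c)).card) := by
  rw [Bool.eq_iff_iff, e.marked_iff, decide_eq_true_iff]

lemma value_eq_iff (c : (ruleTree j).Node) (k : ℕ) :
    (ruleTree j).value c = k ↔ ordinate (word j (e.path c)) = k := by
  have := (inF_iff _).1 (e.inF_word_path c)
  rw [e.value_eq]; omega

/-- For a fixed word, nodes correspond to subsets of its occurrences; `Q` will select all subsets,
or those of a given parity. -/
lemma ncard_setOf_word_eq {w : List Bool} (hw : InF w) (Q : Finset ℕ → Prop) [DecidablePred Q] :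
    {c | word j (e.path c) = w ∧ Q (markedPositions j (e.path c))}.ncard =
      ((occurrences j w).powerset.filter Q).card := by
  rw [← Set.ncard_coe_finset]
  refine Set.ncard_congr (fun c _ => markedPositions j (e.path c)) ?_ ?_ ?_
  · rintro c ⟨rfl, hQ⟩
    simpa [hQ] using markedPositions_subset j (e.path c)
  · rintro c c' ⟨hc, -⟩ ⟨hc', -⟩ h
    exact e.eq_of_word_eq (hc.trans hc'.symm) h
  · intro S hS
    simp only [Finset.coe_filter, Finset.mem_powerset, Set.mem_ofPred_eq] at hS
    obtain ⟨c, hc, rfl⟩ := e.exists_path_eq hw hS.1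
    exact ⟨c, ⟨hc, hS.2⟩, rfl⟩

lemma ncard_marked {w : List Bool} (hw : InF w) :
    {c | word j (e.path c) = w ∧ (ruleTree j).marked c = true}.ncard =
      ((occurrences j w).powerset.filter fun S => Odd S.card).card := by
  simp only [e.marked_iff]
  exact e.ncard_setOf_word_eq hw fun S => Odd S.card

lemma ncard_not_marked {w : List Bool} (hw : InF w) :
    {c | word j (e.path c) = w ∧ (ruleTree j).marked c = false}.ncard =
      ((occurrences j w).powerset.filter fun S => ¬ Odd S.card).card := by
  simp only [← Bool.not_eq_true, e.marked_iff]
  exact e.ncard_setOf_word_eq hw fun S => ¬ Odd S.card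

end LabelledDigraph.Iso

/-- The difference is the alternating sum of `(-1) ^ S.card` over all subsets, which vanishes unless
`s` is empty. -/
lemma card_even_sub_card_odd (s : Finset ℕ) :
    ((s.powerset.filter fun S => ¬ Odd S.card).card : ℤ) -
      (s.powerset.filter fun S => Odd S.card).card = if s = ∅ then 1 else 0 := by
  rw [← Finset.sum_powerset_neg_one_pow_card,
    ← Finset.sum_filter_add_sum_filter_not s.powerset fun S => Odd S.card,
    Finset.sum_congr rfl fun S hS => (Finset.mem_filter.1 hS).2.neg_one_pow,
    Finset.sum_congr (s₁ := s.powerset.filter fun S => ¬ Odd S.card) rfl fun S hS =>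
      (Nat.not_odd_iff_even.1 (Finset.mem_filter.1 hS).2).neg_one_pow]
  simp; ring

lemma card_filter_powerset_of_nonempty {s : Finset ℕ} (hs : s ≠ ∅) :
    (s.powerset.filter fun S => Odd S.card).card = 2 ^ (s.card - 1) ∧
      (s.powerset.filter fun S => ¬ Odd S.card).card = 2 ^ (s.card - 1) := by
  have h1 := card_even_sub_card_odd s
  have h2 := Finset.card_filter_add_card_filter_not (s := s.powerset) fun S => Odd S.card
  rw [if_neg hs] at h1
  rw [Finset.card_powerset] at h2
  have h3 : 0 < s.card := Finset.card_pos.2 (Finset.nonempty_iff_ne_empty.2 hs)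
  have h4 : 2 ^ s.card = 2 ^ (s.card - 1) * 2 := by rw [← pow_succ]; congr 1; omega
  omega

namespace LabelledDigraph.Iso

variable {j : ℕ} (e : (ruleTree j).Iso (pathTree j))

lemma finite_setOf_word_mem {A : Set (List Bool)} (hA : A.Finite) :
    {c | word j (e.path c) ∈ A}.Finite := by
  have h : {ω | word j ω ∈ A}.Finite := by
    obtain ⟨N, hN⟩ := (hA.image List.length).bddAbove
    exact (List.finite_length_le Piece N).subset fun ω hω =>
      (length_le_length_word j ω).trans (hN ⟨_, hω, rfl⟩)
  exact Set.Finite.preimage (f := e.path) e.path_injective.injOn h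

lemma ncard_setOf_word_mem_insert {A : Set (List Bool)} (hA : A.Finite) {w : List Bool}
    (hw : w ∉ A) (b : Bool) :
    {c | word j (e.path c) ∈ insert w A ∧ (ruleTree j).marked c = b}.ncard =
      {c | word j (e.path c) = w ∧ (ruleTree j).marked c = b}.ncard +
        {c | word j (e.path c) ∈ A ∧ (ruleTree j).marked c = b}.ncard := by
  rw [← Set.ncard_union_eq
    (Set.disjoint_left.2 fun c h h' => hw (by rw [← h.1]; exact h'.1))
    ((e.finite_setOf_word_mem (Set.finite_singleton w)).subset fun c hc => hc.1)
    ((e.finite_setOf_word_mem hA).subset fun c hc => hc.1)]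
  congr 1
  ext c
  simp only [Set.mem_insert_iff, Set.mem_ofPred_eq, Set.mem_union]
  tauto

/-- The copies of a word that contains the pattern cancel. -/
lemma ncard_sub_ncard {A : Set (List Bool)} (hA : A.Finite) (hF : ∀ w ∈ A, InF w) :
    ({c | word j (e.path c) ∈ A ∧ (ruleTree j).marked c = false}.ncard : ℤ) -
      {c | word j (e.path c) ∈ A ∧ (ruleTree j).marked c = true}.ncard =
        {w | w ∈ A ∧ Avoids j w}.ncard := by
  -- Words are added one at a time: each contributes `1` if it has no occurrence and `0` otherwise.
  induction A, hA using Set.Finite.induction_on with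
  | empty => simp
  | @insert w A hw hA ih =>
    have ih' := ih fun w' h => hF w' (Set.mem_insert_of_mem _ h)
    have hwF := hF w (Set.mem_insert _ _)
    have h1 := card_even_sub_card_odd (occurrences j w)
    rw [e.ncard_setOf_word_mem_insert hA hw, e.ncard_setOf_word_mem_insert hA hw,
      e.ncard_marked hwF, e.ncard_not_marked hwF]
    by_cases hav : Avoids j w
    · have h2 : {w' | w' ∈ insert w A ∧ Avoids j w'} = insert w {w' | w' ∈ A ∧ Avoids j w'} := by
        ext w'
        simp only [Set.mem_insert_iff, Set.mem_ofPred_eq]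
        constructor
        · tauto
        · rintro (rfl | h) <;> tauto
      rw [h2, Set.ncard_insert_of_notMem (fun h => hw h.1) (hA.subset fun _ h => h.1)]
      rw [if_pos (avoids_iff.1 hav)] at h1
      push_cast; omega
    · have h2 : {w' | w' ∈ insert w A ∧ Avoids j w'} = {w' | w' ∈ A ∧ Avoids j w'} := by
        ext w'
        simp only [Set.mem_insert_iff, Set.mem_ofPred_eq]
        constructor
        · rintro ⟨rfl | h, h'⟩ <;> tauto
        · tauto
      rw [h2]
      rw [if_neg (mt avoids_iff.2 hav)] at h1
      push_cast; omega

end LabelledDigraph.Iso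

lemma odd_card_symmDiff_singleton (S : Finset ℕ) (m : ℕ) :
    Odd (symmDiff S {m}).card ↔ ¬ Odd S.card := by
  by_cases hm : m ∈ S
  · have h : symmDiff S {m} = S.erase m := by
      ext i; simp only [Finset.mem_symmDiff, Finset.mem_singleton, Finset.mem_erase]
      by_cases hi : i = m <;> simp [hi, hm]
    rw [h, ← Finset.card_erase_add_one hm, Nat.odd_add_one, not_not]
  · have h : symmDiff S {m} = insert m S := by
      ext i; simp only [Finset.mem_symmDiff, Finset.mem_singleton, Finset.mem_insert]
      by_cases hi : i = m <;> simp [hi, hm]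
    rw [h, Finset.card_insert_of_notMem hm, Nat.odd_add_one]

end PatternTree

theorem mainTheorem1 (j : ℕ) (hj : 1 ≤ j) :
    (PatternTree.pathTree j).IsRootedTree ∧
    ∃ e : (PatternTree.ruleTree j).Iso (PatternTree.pathTree j),
      -- every path of `F`, with every choice of marked forbidden patterns, is generated once
      (∀ w, PatternTree.InF w → ∀ S ⊆ PatternTree.occurrences j w,
        ∃! c, PatternTree.word j (e.path c) = w ∧ PatternTree.markedPositions j (e.path c) = S) ∧
      -- the marked forbidden patterns are occurrences of the pattern, and the label is marked
      -- exactly if their number is odd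
      (∀ c, PatternTree.markedPositions j (e.path c) ⊆
          PatternTree.occurrences j (PatternTree.word j (e.path c)) ∧
        ((PatternTree.ruleTree j).marked c = true ↔
          Odd (PatternTree.markedPositions j (e.path c)).card)) ∧
      -- a path with `C` forbidden patterns is generated `2 ^ C` times
      (∀ w, PatternTree.InF w →
        {c | PatternTree.word j (e.path c) = w}.ncard =
          2 ^ (PatternTree.occurrences j w).card) ∧
      -- if `C ≥ 1` then half of the copies are marked and half are not
      (∀ w, PatternTree.InF w → ¬ PatternTree.Avoids j w →
        {c | PatternTree.word j (e.path c) = w ∧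
            (PatternTree.ruleTree j).marked c = true}.ncard =
          2 ^ ((PatternTree.occurrences j w).card - 1) ∧
        {c | PatternTree.word j (e.path c) = w ∧
            (PatternTree.ruleTree j).marked c = false}.ncard =
          2 ^ ((PatternTree.occurrences j w).card - 1)) ∧
      -- a path that avoids the pattern is generated exactly once, with a non-marked label
      (∀ w, PatternTree.InF w → PatternTree.Avoids j w →
        (∃! c, PatternTree.word j (e.path c) = w) ∧
        ∀ c, PatternTree.word j (e.path c) = w → (PatternTree.ruleTree j).marked c = false) ∧
      -- a generated path that contains the pattern is killed by exactly one other copy of it, on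
      -- the same level, with the opposite label, and with the mark of the last pattern changed
      (∀ c m, IsGreatest
          (PatternTree.occurrences j (PatternTree.word j (e.path c)) : Set ℕ) m →
        ∃! c', PatternTree.word j (e.path c') = PatternTree.word j (e.path c) ∧
          PatternTree.markedPositions j (e.path c') =
            symmDiff (PatternTree.markedPositions j (e.path c)) {m} ∧
          (PatternTree.ruleTree j).level c' = (PatternTree.ruleTree j).level c ∧
          (PatternTree.ruleTree j).value c' = (PatternTree.ruleTree j).value c ∧
          (PatternTree.ruleTree j).marked c' = !(PatternTree.ruleTree j).marked c) ∧
      -- the levels of the tree are finite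
      (∀ n, {c | (PatternTree.ruleTree j).level c = n}.Finite) ∧
      -- after cancellation, level `n` counts the paths of `F` that avoid the pattern and have `n`
      -- ones, by the ordinate of the endpoint and in total
      (∀ n k : ℕ,
        ({c | (PatternTree.ruleTree j).level c = n ∧ (PatternTree.ruleTree j).value c = k ∧
            (PatternTree.ruleTree j).marked c = false}.ncard : ℤ) -
          ({c | (PatternTree.ruleTree j).level c = n ∧ (PatternTree.ruleTree j).value c = k ∧
            (PatternTree.ruleTree j).marked c = true}.ncard : ℤ) =
          ({w | PatternTree.InF w ∧ PatternTree.Avoids j w ∧ w.count true = n ∧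
            PatternTree.ordinate w = k}.ncard : ℤ)) ∧
      (∀ n : ℕ,
        ({c | (PatternTree.ruleTree j).level c = n ∧
            (PatternTree.ruleTree j).marked c = false}.ncard : ℤ) -
          ({c | (PatternTree.ruleTree j).level c = n ∧
            (PatternTree.ruleTree j).marked c = true}.ncard : ℤ) =
          ({w | PatternTree.InF w ∧ PatternTree.Avoids j w ∧ w.count true = n}.ncard : ℤ)) := by

  open PatternTree in
  -- From here on, only the defining properties of an isomorphism are used, not this particular one.
  have e := treeIso j
  refine ⟨e.isRootedTree (ruleTree_isRootedTree j), e, ?_, ?_, ?_, ?_, ?_, ?_, ?_, ?_, ?_⟩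
  · intro w hw S hS
    obtain ⟨c, hc, hc'⟩ := e.exists_path_eq hw hS
    exact ⟨c, ⟨hc, hc'⟩, fun c' h => e.eq_of_word_eq (h.1.trans hc.symm) (h.2.trans hc'.symm)⟩
  · exact fun c => ⟨markedPositions_subset j _, e.marked_iff c⟩
  · intro w hw
    have := e.ncard_setOf_word_eq hw fun _ => True
    simpa using this
  · intro w hw hav
    have := card_filter_powerset_of_nonempty (mt avoids_iff.2 hav)
    exact ⟨(e.ncard_marked hw).trans this.1, (e.ncard_not_marked hw).trans this.2⟩
  · intro w hw hav
    have hocc := avoids_iff.1 hav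
    have hempty : ∀ c, word j (e.path c) = w → markedPositions j (e.path c) = ∅ := by
      rintro c rfl
      exact Finset.subset_empty.1 (hocc ▸ markedPositions_subset j (e.path c))
    obtain ⟨c, hc, -⟩ := e.exists_path_eq hw (Finset.empty_subset _)
    refine ⟨⟨c, hc, fun c' hc' => e.eq_of_word_eq (hc'.trans hc.symm)
      ((hempty c' hc').trans (hempty c hc).symm)⟩, fun c hc => ?_⟩
    rw [e.marked_eq, hempty c hc]
    simp
  · intro c m hm
    have hS : symmDiff (markedPositions j (e.path c)) {m} ⊆ occurrences j (word j (e.path c)) := by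
      refine Finset.symmDiff_subset_union.trans (Finset.union_subset (markedPositions_subset j _) ?_)
      exact Finset.singleton_subset_iff.2 hm.1
    obtain ⟨c', hc', hm'⟩ := e.exists_path_eq (e.inF_word_path c) hS
    refine ⟨c', ⟨hc', hm', ?_, ?_, ?_⟩, fun c'' h =>
      e.eq_of_word_eq (h.1.trans hc'.symm) (h.2.1.trans hm'.symm)⟩
    · rw [e.level_eq, e.level_eq, hc']
    · rw [e.value_eq, e.value_eq, hc']
    · rw [e.marked_eq, e.marked_eq, hm', ← decide_not]
      exact decide_eq_decide.2 (odd_card_symmDiff_singleton _ _)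
  · intro n
    -- In `F`, `n` ones bound the length of a word by `2 * n`, and a marked path has at most as many
    -- pieces as letters.
    refine (e.finite_setOf_word_mem (finite_words n)).subset fun c hc => ?_
    exact ⟨e.inF_word_path c, (e.level_eq c).symm.trans hc⟩
  · intro n k
    have := e.ncard_sub_ncard (A := {w | InF w ∧ w.count true = n ∧ ordinate w = k})
      ((finite_words n).subset fun w h => ⟨h.1, h.2.1⟩) fun w h => h.1
    simp only [Set.mem_ofPred_eq, e.inF_word_path, true_and, and_assoc] at this
    simp only [e.level_eq, e.value_eq_iff]
    convert this using 3
    ext; simp only [Set.mem_ofPred_eq]; tauto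
  · intro n
    have := e.ncard_sub_ncard (A := {w | InF w ∧ w.count true = n}) (finite_words n)
      fun w h => h.1
    simp only [Set.mem_ofPred_eq, e.inF_word_path, true_and, and_assoc] at this
    simp only [e.level_eq]
    convert this using 3
    ext; simp only [Set.mem_ofPred_eq]; tauto
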